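/- Let $X$ be a smooth projective (irreducible) curve over $\mathbb{C}$ with function field $K(X)$, let $E$ and $L$ be vector bundles on $X$ of ranks $n$ and $1$, put $F=\mathrm{Hom}(E,L)$, and assume that $\mathrm{Hom}(F,E)$ has no nonzero global sections. For a vector bundle $V$ write $\mathrm{Rat}(V)$ for its rational sections, $\mathrm{Prin}(V)$ for its principal parts (the global sections of the quotient of the constant sheaf $\underline{\mathrm{Rat}}(V)$ by the sheaf $\mathcal V$ of regular sections), and $\overline{s}\in\mathrm{Prin}(V)$ for the principal part of $s\in\mathrm{Rat}(V)$. The transpose of $\gamma\in\mathrm{Rat}(\mathrm{Hom}(F,E))$ is defined by $\psi({}^t\gamma(\varphi))=\varphi(\gamma(\psi))$, and it induces a transpose on $\mathrm{Prin}(\mathrm{Hom}(F,E))$. Let $p\in\mathrm{Prin}(\mathrm{Hom}(F,E))$ and let $0\to E\to W\to F\to 0$ be the extension whose sheaf of sections is $$\mathcal{W}_p=\{(e,\varphi)\in\underline{\mathrm{Rat}}(E)\oplus\underline{\mathrm{Rat}}(F) : \varphi \text{ is regular and } \overline{e}=p(\varphi)\}.$$ For $q\in\mathrm{Prin}(\mathrm{Hom}(F,E))$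 and a subbundle $G\subset W$ with sheaf of sections $\mathcal G$, write $\mathcal{G}=\mathrm{Ker}(q)$ if there is $\beta\in\mathrm{Rat}(\mathrm{Hom}(F,E))$ (necessarily unique) with $q=p-\overline{\beta}$ such that $\mathcal{G}=\{(\beta(\varphi),\varphi) : \varphi\in\mathrm{Ker}(q\colon\mathcal F\to\mathcal{P}rin(E))\}$, i.e. $\mathcal G$ is the lift of $\mathrm{Ker}(q)\subset\mathcal F$ to $\mathcal W_p$ by $\varphi\mapsto(\beta(\varphi),\varphi)$. (Symplectic case.) Suppose ${}^tp-p=\overline{\alpha}$ with $\alpha\in\mathrm{Rat}(\mathrm{Hom}(F,E))$ (which is then automatically antisymmetric). Then $$\theta((e_1,\varphi_1),(e_2,\varphi_2))=\varphi_1(e_2)-\varphi_2(e_1)-\varphi_2(\alpha(\varphi_1))$$ is an $L$-valued symplectic form on $W$. Every subbundle $G\subset W$ of rank $n$ that meets $E$ trivially at the generic point satisfies $\mathcal{G}=\mathrm{Ker}(q)$ for exactly one $q\in\mathrm{Prin}(\mathrm{Hom}(F,E))$, and $G$ is isotropic with respect to $\theta$ if and only if this $q$ is symmetric, ${}^tq=q$.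 (Orthogonal case.) Suppose ${}^tp+p=\overline{\alpha}$ with $\alpha\in\mathrm{Rat}(\mathrm{Hom}(F,E))$ (which is then automatically symmetric). Then $$\theta((e_1,\varphi_1),(e_2,\varphi_2))=\varphi_1(e_2)+\varphi_2(e_1)-\varphi_2(\alpha(\varphi_1))$$ is an $L$-valued orthogonal (nondegenerate symmetric) form on $W$. Every subbundle $G\subset W$ of rank $n$ that meets $E$ trivially at the generic point satisfies $\mathcal{G}=\mathrm{Ker}(q)$ for exactly one $q\in\mathrm{Prin}(\mathrm{Hom}(F,E))$, and $G$ is isotropic with respect to $\theta$ if and only if this $q$ is antisymmetric, ${}^tq=-q$. -/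

import Mathlib

open AlgebraicGeometry CategoryTheory TopologicalSpace

noncomputable section

namespace CurveBundles

universe u

section ProjectiveSchemes

attribute [local instance] MvPolynomial.gradedAlgebra

/-- Projective space of dimension `N` over `ℂ`. -/
abbrev projectiveSpace (N : ℕ) : Scheme.{0} :=
  Proj (MvPolynomial.homogeneousSubmodule (Fin (N + 1)) ℂ)

/-- The structure morphism of complex projective space. -/
def projectiveSpaceToSpec (N : ℕ) : projectiveSpace N ⟶ Spec (.of ℂ) :=
  Proj.toSpecZero _ ≫ Spec.map (CommRingCat.ofHom
    (algebraMap ℂ (MvPolynomial.homogeneousSubmodule (Fin (N + 1)) ℂ 0)))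

/-- A complex scheme is projective if it is a closed subscheme of some projective space. -/
def IsProjective {X : Scheme.{0}} (s : X ⟶ Spec (.of ℂ)) : Prop :=
  ∃ (N : ℕ) (i : X ⟶ projectiveSpace N), IsClosedImmersion i ∧ i ≫ projectiveSpaceToSpec N = s

end ProjectiveSchemes

section LocalRings

variable {X : Scheme.{u}} [IsIntegral X]

/-- The local ring `𝒪_{X,x}`, as a subring of the function field `K(X)`. -/
abbrev localRing (x : X) : Subring X.functionField :=
  (algebraMap (X.presheaf.stalk x) X.functionField).range

theorem genericPoint_mem {x : X} {U : X.Opens} (hx : x ∈ U) : genericPoint X ∈ U :=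
  ((genericPoint_spec X).mem_open_set_iff U.2).2 ⟨x, trivial, hx⟩

theorem germ_mem_localRing {x : X} {U : X.Opens} (hx : x ∈ U) (r : Γ(X, U)) :
    X.presheaf.germ U (genericPoint X) (genericPoint_mem hx) r ∈ localRing x := by
  refine ⟨X.presheaf.germ U x hx r, ?_⟩
  have : Nonempty U := ⟨⟨x, hx⟩⟩
  exact Scheme.algebraMap_germ_eq_germToFunctionField X hx r

theorem exists_germ_of_mem_localRing {x : X} {a : X.functionField} (ha : a ∈ localRing x) :
    ∃ (U : X.Opens) (hx : x ∈ U) (r : Γ(X, U)),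
      X.presheaf.germ U (genericPoint X) (genericPoint_mem hx) r = a := by
  obtain ⟨s, rfl⟩ := ha
  obtain ⟨U, hx, r, rfl⟩ := X.presheaf.exists_germ_eq s
  have : Nonempty U := ⟨⟨x, hx⟩⟩
  exact ⟨U, hx, r, (Scheme.algebraMap_germ_eq_germToFunctionField X hx r).symm⟩

end LocalRings

/-- A vector bundle on an integral scheme `X`, given as its sheaf of regular sections inside the
constant sheaf of rational sections: a vector space `Rat` over the function field (the rational
sections) with, for each point `x`, the `𝒪_{X,x}`-submodule `stalk x` of those rational sections
that are regular at `x`; locally on `X` there is a frame, i.e. a basis of `Rat` that generates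
all the stalks freely. The regular sections over an open set `U` are the members of
`⋂_{x ∈ U} stalk x`. -/
structure VectorBundle (X : Scheme.{u}) [IsIntegral X] where
  Rat : Type u
  [addCommGroup : AddCommGroup Rat]
  [module : Module X.functionField Rat]
  stalk : ∀ x : X, Submodule (localRing x) Rat
  rank : ℕ
  locallyFree : ∀ x : X, ∃ U : X.Opens, x ∈ U ∧
    ∃ b : Module.Basis (Fin rank) X.functionField Rat,
      ∀ y ∈ U, stalk y = Submodule.span (localRing y) (Set.range b)

attribute [instance] VectorBundle.addCommGroup VectorBundle.module

section SheavesOfModules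

variable {X : Scheme.{u}}

/-- `M` is locally free of rank `r`: locally there are `r` sections whose restrictions
form a basis of the sections of `M` over every smaller open set. -/
def IsLocallyFreeOfRank (M : X.Modules) (r : ℕ) : Prop :=
  ∀ x : X, ∃ U : X.Opens, x ∈ U ∧ ∃ e : Fin r → Γ(M, U), ∀ (V : X.Opens) (i : V ≤ U),
    LinearIndependent Γ(X, V) (fun k => M.presheaf.map (homOfLE i).op (e k)) ∧
    Submodule.span Γ(X, V) (Set.range fun k => M.presheaf.map (homOfLE i).op (e k)) = ⊤

instance stalkModule (M : X.Modules) (x : X) :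
    Module (X.presheaf.stalk x) (M.presheaf.stalk x) :=
  PresheafOfModules.instModuleCarrierStalkCommRingCatCarrierAbPresheafOpensCarrier
    (R := X.presheaf) M.val x

theorem germ_smul (M : X.Modules) {x : X} {U : X.Opens} (hx : x ∈ U) (r : Γ(X, U))
    (m : Γ(M, U)) : M.presheaf.germ U x hx (r • m) =
      X.presheaf.germ U x hx r • M.presheaf.germ U x hx m :=
  PresheafOfModules.germ_smul (R := X.presheaf) M.val x U hx r m

variable [IsIntegral X]

/-- The rational sections of a sheaf of modules: its stalk at the generic point of `X`. -/
abbrev RatSections (M : X.Modules) : Type u := M.presheaf.stalk (genericPoint X)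

instance (M : X.Modules) : Module X.functionField (RatSections M) :=
  stalkModule M (genericPoint X)

theorem germ_smul_rat (M : X.Modules) {U : X.Opens} (hx : genericPoint X ∈ U) (r : Γ(X, U))
    (m : Γ(M, U)) : (M.presheaf.germ U (genericPoint X) hx (r • m) : RatSections M) =
      (X.presheaf.germ U (genericPoint X) hx r : X.functionField) •
        (M.presheaf.germ U (genericPoint X) hx m : RatSections M) :=
  germ_smul M hx r m

/-- The rational sections of `M` that are regular at `x`. -/
def regularAt (M : X.Modules) (x : X) : Submodule (localRing x) (RatSections M) where
  carrier := {s | ∃ (U : X.Opens) (hx : x ∈ U) (m : Γ(M, U)),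
    M.presheaf.germ U (genericPoint X) (genericPoint_mem hx) m = s}
  zero_mem' := ⟨⊤, trivial, 0, map_zero _⟩
  add_mem' := by
    rintro _ _ ⟨U, hx, m, rfl⟩ ⟨V, hy, n, rfl⟩
    refine ⟨U ⊓ V, ⟨hx, hy⟩, M.presheaf.map (homOfLE inf_le_left).op m +
      M.presheaf.map (homOfLE inf_le_right).op n, ?_⟩
    rw [map_add, TopCat.Presheaf.germ_res_apply, TopCat.Presheaf.germ_res_apply]
  smul_mem' := by
    rintro ⟨a, ha⟩ _ ⟨U, hx, m, rfl⟩
    obtain ⟨V, hy, r, rfl⟩ := exists_germ_of_mem_localRing ha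
    refine ⟨V ⊓ U, ⟨hy, hx⟩, X.presheaf.map (homOfLE (inf_le_left : V ⊓ U ≤ V)).op r •
      M.presheaf.map (homOfLE (inf_le_right : V ⊓ U ≤ U)).op m, ?_⟩
    rw [germ_smul_rat, TopCat.Presheaf.germ_res_apply, TopCat.Presheaf.germ_res_apply]
    rfl

theorem exists_germ_eq_zero (M : X.Modules) {U : X.Opens} (hU : genericPoint X ∈ U) (m : Γ(M, U))
    (h : M.presheaf.germ U (genericPoint X) hU m = 0) :
    ∃ (V : X.Opens) (_ : genericPoint X ∈ V) (i : V ≤ U), M.presheaf.map (homOfLE i).op m = 0 := by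
  obtain ⟨V, hV, i, j, hij⟩ := M.presheaf.germ_eq (genericPoint X) hU hU m 0 (by rw [h, map_zero])
  exact ⟨V, hV, i.le, by rw [map_zero] at hij; exact hij⟩

theorem exists_frame {M : X.Modules} {r : ℕ} (h : IsLocallyFreeOfRank M r) (x : X) :
    ∃ U : X.Opens, x ∈ U ∧ ∃ b : Module.Basis (Fin r) X.functionField (RatSections M),
      ∀ y ∈ U, regularAt M y = Submodule.span (localRing y) (Set.range b) := by
  obtain ⟨U, hx, e, he⟩ := h x
  have hη := genericPoint_mem hx
  let v : Fin r → RatSections M := fun k => M.presheaf.germ U (genericPoint X) hη (e k)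
  have hspan : ∀ y ∈ U, regularAt M y = Submodule.span (localRing y) (Set.range v) := by
    intro y hy
    apply le_antisymm
    · rintro _ ⟨V, hyV, m, rfl⟩
      have hW : y ∈ V ⊓ U := ⟨hyV, hy⟩
      have hm : M.presheaf.map (homOfLE (inf_le_left : V ⊓ U ≤ V)).op m ∈
          Submodule.span Γ(X, V ⊓ U) (Set.range fun k =>
            M.presheaf.map (homOfLE (inf_le_right : V ⊓ U ≤ U)).op (e k)) := by
        rw [(he _ inf_le_right).2]; trivial
      obtain ⟨c, hc⟩ := (Submodule.mem_span_range_iff_exists_fun _).1 hm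
      rw [← TopCat.Presheaf.germ_res_apply M.presheaf (homOfLE (inf_le_left : V ⊓ U ≤ V))
        (genericPoint X) (genericPoint_mem hW) m, ← hc, map_sum]
      refine Submodule.sum_mem _ fun k _ => ?_
      rw [germ_smul_rat, TopCat.Presheaf.germ_res_apply]
      exact Submodule.smul_mem _
        (⟨_, germ_mem_localRing hW (c k)⟩ : localRing y) (Submodule.subset_span ⟨k, rfl⟩)
    · rw [Submodule.span_le]
      rintro _ ⟨k, rfl⟩
      exact ⟨U, hy, e k, rfl⟩
  have hli : LinearIndependent X.functionField v := by
    rw [Fintype.linearIndependent_iff]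
    intro g hg
    have hloc : ∀ k, ∃ (V : X.Opens) (_ : genericPoint X ∈ V) (a : Γ(X, V)),
        X.presheaf.germ V (genericPoint X) ‹_› a = g k := fun k =>
      X.presheaf.exists_germ_eq (g k)
    choose V hV a ha using hloc
    let W : X.Opens := (Finset.univ.inf V) ⊓ U
    have hW : genericPoint X ∈ W := by
      refine ⟨?_, hη⟩
      have : ∀ s : Finset (Fin r), genericPoint X ∈ s.inf V := by
        intro s
        induction s using Finset.cons_induction with
        | empty => trivial
        | cons i s hi ih => rw [Finset.inf_cons]; exact ⟨hV i, ih⟩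
      exact this _
    have hWV : ∀ k, W ≤ V k := fun k => inf_le_left.trans (Finset.inf_le (Finset.mem_univ k))
    have hWU : W ≤ U := inf_le_right
    let m : Γ(M, W) := ∑ k, X.presheaf.map (homOfLE (hWV k)).op (a k) •
      M.presheaf.map (homOfLE hWU).op (e k)
    have hm : M.presheaf.germ W (genericPoint X) hW m = 0 := by
      rw [← hg, map_sum]
      refine Finset.sum_congr rfl fun k _ => ?_
      rw [germ_smul_rat, TopCat.Presheaf.germ_res_apply, TopCat.Presheaf.germ_res_apply, ha]
    obtain ⟨W', hW', i, h0⟩ := exists_germ_eq_zero M hW m hm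
    have hz := Fintype.linearIndependent_iff.1 (he W' (i.trans hWU)).1
      (fun k => X.presheaf.map (homOfLE (i.trans (hWV k))).op (a k)) (by
        rw [← h0, map_sum]
        refine Finset.sum_congr rfl fun k _ => ?_
        rw [Scheme.Modules.map_smul, ← ConcreteCategory.comp_apply, ← ConcreteCategory.comp_apply,
          ← Functor.map_comp, ← Functor.map_comp]
        rfl)
    intro k
    rw [← ha k, ← TopCat.Presheaf.germ_res_apply X.presheaf (homOfLE (i.trans (hWV k)))
      (genericPoint X) hW' (a k), hz k, map_zero]
  refine ⟨U, hx, Module.Basis.mk hli ?_, fun y hy => by rw [Module.Basis.coe_mk, hspan y hy]⟩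
  intro s _
  obtain ⟨V, hV, m, rfl⟩ := M.presheaf.exists_germ_eq s
  have hs : (M.presheaf.germ V (genericPoint X) hV m : RatSections M) ∈
      regularAt M (genericPoint X) := ⟨V, hV, m, rfl⟩
  rw [hspan _ hη] at hs
  exact Submodule.span_le_restrictScalars (localRing (genericPoint X)) X.functionField _ hs

/-- The vector bundle with a given locally free sheaf of sections. -/
abbrev VectorBundle.ofModules {M : X.Modules} {r : ℕ} (h : IsLocallyFreeOfRank M r) :
    VectorBundle X where
  Rat := RatSections M
  stalk := regularAt M
  rank := r
  locallyFree := exists_frame h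

end SheavesOfModules

section Bundles

variable {X : Scheme.{u}} [IsIntegral X]

/-- A vector lies in the `𝒪_{X,x}`-span of a basis iff its coordinates lie in `𝒪_{X,x}`. -/
theorem mem_span_frame {ι V : Type*} [AddCommGroup V] [Module X.functionField V] {x : X}
    (b : Module.Basis ι X.functionField V) (v : V) :
    v ∈ Submodule.span (localRing x) (Set.range b) ↔ ∀ i, b.repr v i ∈ localRing x := by
  rw [b.mem_span_iff_repr_mem (localRing x)]
  refine forall_congr' fun i => ⟨?_, fun h => ⟨⟨_, h⟩, rfl⟩⟩
  rintro ⟨a, ha⟩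
  rw [← ha]
  exact a.2

namespace VectorBundle

/-- The global regular sections of a vector bundle. -/
def globalSections (E : VectorBundle X) : Set E.Rat := {s | ∀ x, s ∈ E.stalk x}

section Hom

variable (E F : VectorBundle X)

/-- The rational homomorphisms `E → F` that are regular at `x`. -/
def homStalk (x : X) : Submodule (localRing x) (E.Rat →ₗ[X.functionField] F.Rat) where
  carrier := {φ | ∀ e ∈ E.stalk x, φ e ∈ F.stalk x}
  add_mem' h h' _ he := add_mem (h _ he) (h' _ he)
  zero_mem' _ _ := zero_mem _
  smul_mem' a _ h _ he := (F.stalk x).smul_mem a (h _ he)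

/-- The vector bundle `Hom(E, F)`. -/
abbrev hom : VectorBundle X where
  Rat := E.Rat →ₗ[X.functionField] F.Rat
  stalk := homStalk E F
  rank := F.rank * E.rank
  locallyFree x := by
    obtain ⟨U, hU, b, hb⟩ := E.locallyFree x
    obtain ⟨V, hV, c, hc⟩ := F.locallyFree x
    refine ⟨U ⊓ V, ⟨hU, hV⟩, (b.linearMap c).reindex finProdFinEquiv, fun y hy => ?_⟩
    rw [Module.Basis.range_reindex]
    ext φ
    have key : ∀ i j, (b.linearMap c).repr φ (i, j) = c.repr (φ (b j)) i := by
      intro i j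
      exact LinearMap.toMatrix_apply b c φ i j
    rw [mem_span_frame]
    constructor
    · rintro h ⟨i, j⟩
      have := h (b j) (by rw [hb y hy.1]; exact Submodule.subset_span ⟨j, rfl⟩)
      rw [hc y hy.2, mem_span_frame] at this
      rw [key]
      exact this i
    · intro h e he
      rw [hb y hy.1] at he
      induction he using Submodule.span_induction with
      | mem _ hx =>
        obtain ⟨j, rfl⟩ := hx
        rw [hc y hy.2, mem_span_frame]
        exact fun i => key i j ▸ h (i, j)
      | zero => rw [map_zero]; exact zero_mem _
      | add _ _ _ _ h1 h2 => rw [map_add]; exact add_mem h1 h2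
      | smul a m _ h1 =>
        have : φ (a • m) = a • φ m := φ.map_smul (a : X.functionField) m
        rw [this]
        exact Submodule.smul_mem _ a h1

end Hom

section PrincipalParts

variable (E F : VectorBundle X)

/-- The group `Prin(E)` of principal parts with values in `E`: the global sections of the
quotient of the constant sheaf of rational sections by the sheaf of regular sections, that is,
the families of classes in the stalks `Rat(E) / E_x` that locally come from a rational section. -/
def Prin : AddSubgroup (∀ x : X, E.Rat ⧸ E.stalk x) where
  carrier := {p | ∀ x, ∃ U : X.Opens, x ∈ U ∧ ∃ s : E.Rat, ∀ y ∈ U, p y = Submodule.Quotient.mk s}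
  zero_mem' x := ⟨⊤, trivial, 0, fun _ _ => rfl⟩
  add_mem' h h' x := by
    obtain ⟨U, hU, s, hs⟩ := h x
    obtain ⟨V, hV, t, ht⟩ := h' x
    refine ⟨U ⊓ V, ⟨hU, hV⟩, s + t, fun y hy => ?_⟩
    rw [Pi.add_apply, hs y hy.1, ht y hy.2]
    rfl
  neg_mem' h x := by
    obtain ⟨U, hU, s, hs⟩ := h x
    refine ⟨U, hU, -s, fun y hy => ?_⟩
    rw [Pi.neg_apply, hs y hy]
    rfl

/-- The principal part of a rational section. -/
def principalPart : E.Rat →+ E.Prin where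
  toFun s := ⟨fun _ => Submodule.Quotient.mk s, fun _ => ⟨⊤, trivial, s, fun _ _ => rfl⟩⟩
  map_zero' := rfl
  map_add' _ _ := rfl

variable {E F}

/-- Evaluation of the germ at `x` of a principal part with values in `Hom(F, E)` on a section `f`
of `F` that is regular at `x`; the value is the germ at `x` of a principal part of `E`. -/
def evalAt {x : X} (f : F.stalk x) :
    ((hom F E).Rat ⧸ (hom F E).stalk x) →ₗ[localRing x] (E.Rat ⧸ E.stalk x) :=
  Submodule.mapQ _ _ ((LinearMap.applyₗ (R := X.functionField) (M₂ := E.Rat)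
    (f : F.Rat)).restrictScalars (localRing x)) fun _ h => h f f.2

theorem evalAt_mk {x : X} (f : F.stalk x) (π : (hom F E).Rat) :
    evalAt f (Submodule.Quotient.mk π) = (Submodule.Quotient.mk (π f) : E.Rat ⧸ E.stalk x) := rfl

/-- The stalk at `x` of `𝒲_p = {(e, f) ∈ Rat(E) ⊕ Rat(F) : f is regular and ē = p(f)}`. -/
def extensionStalk (p : (hom F E).Prin) (x : X) : Submodule (localRing x) (E.Rat × F.Rat) where
  carrier := {w | ∃ hf : w.2 ∈ F.stalk x, Submodule.Quotient.mk w.1 = evalAt ⟨w.2, hf⟩ (p.1 x)}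
  zero_mem' := by
    obtain ⟨π, hπ⟩ := Submodule.Quotient.mk_surjective _ (p.1 x)
    refine ⟨zero_mem _, ?_⟩
    rw [← hπ, evalAt_mk]
    simp
  add_mem' := by
    obtain ⟨π, hπ⟩ := Submodule.Quotient.mk_surjective _ (p.1 x)
    rintro v w ⟨hv, hv'⟩ ⟨hw, hw'⟩
    refine ⟨add_mem hv hw, ?_⟩
    rw [← hπ, evalAt_mk] at hv' hw' ⊢
    simp only [Prod.fst_add, Prod.snd_add, map_add, Submodule.Quotient.mk_add, hv', hw']
  smul_mem' := by
    obtain ⟨π, hπ⟩ := Submodule.Quotient.mk_surjective _ (p.1 x)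
    rintro a w ⟨hw, hw'⟩
    refine ⟨Submodule.smul_mem _ a hw, ?_⟩
    rw [← hπ, evalAt_mk] at hw' ⊢
    have : π (a • w).2 = a • π w.2 := π.map_smul (a : X.functionField) w.2
    rw [this, Prod.smul_fst, Submodule.Quotient.mk_smul, Submodule.Quotient.mk_smul, hw']

theorem mem_extensionStalk {p : (hom F E).Prin} {x : X} {π : (hom F E).Rat}
    (hπ : p.1 x = Submodule.Quotient.mk π) (w : E.Rat × F.Rat) :
    w ∈ extensionStalk p x ↔ w.2 ∈ F.stalk x ∧ w.1 - π w.2 ∈ E.stalk x := by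
  constructor
  · rintro ⟨hf, h⟩
    rw [hπ, evalAt_mk, Submodule.Quotient.eq] at h
    exact ⟨hf, h⟩
  · rintro ⟨hf, h⟩
    refine ⟨hf, ?_⟩
    rw [hπ, evalAt_mk, Submodule.Quotient.eq]
    exact h

/-- The automorphism `(e, f) ↦ (e + π f, f)`. -/
def shear (π : (hom F E).Rat) : (E.Rat × F.Rat) ≃ₗ[X.functionField] (E.Rat × F.Rat) where
  toFun w := (w.1 + π w.2, w.2)
  invFun w := (w.1 - π w.2, w.2)
  map_add' v w := by ext <;> simp [add_add_add_comm]
  map_smul' a w := by ext <;> simp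
  left_inv w := by ext <;> simp
  right_inv w := by ext <;> simp

/-- The extension `0 → E → W → F → 0` defined by a principal part `p`. Its sheaf of sections
is `𝒲_p`, the subsheaf `E` consists of the `(e, 0)`, and the map to `F` is `(e, f) ↦ f`. -/
abbrev extension (p : (hom F E).Prin) : VectorBundle X where
  Rat := E.Rat × F.Rat
  stalk := extensionStalk p
  rank := E.rank + F.rank
  locallyFree x := by
    obtain ⟨U, hU, b, hb⟩ := E.locallyFree x
    obtain ⟨V, hV, c, hc⟩ := F.locallyFree x
    obtain ⟨T, hT, π, hπ⟩ := p.2 x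
    refine ⟨U ⊓ V ⊓ T, ⟨⟨hU, hV⟩, hT⟩, ((b.prod c).map (shear π)).reindex finSumFinEquiv,
      fun y hy => ?_⟩
    rw [Module.Basis.range_reindex]
    ext w
    rw [mem_span_frame, mem_extensionStalk (hπ y hy.2), hb y hy.1.1, hc y hy.1.2, mem_span_frame,
      mem_span_frame, Sum.forall, and_comm]
    simp [shear]

end PrincipalParts

section Transpose

variable {E L : VectorBundle X}

theorem finrank_rat (E : VectorBundle X) : Module.finrank X.functionField E.Rat = E.rank := by
  obtain ⟨_, _, b, _⟩ := E.locallyFree (genericPoint X)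
  rw [Module.finrank_eq_card_basis b, Fintype.card_fin]

instance finite_rat (E : VectorBundle X) : Module.Finite X.functionField E.Rat := by
  obtain ⟨_, _, b, _⟩ := E.locallyFree (genericPoint X)
  exact Module.Finite.of_basis b

theorem eval_bijective (hL : L.rank = 1) : Function.Bijective
    (LinearMap.applyₗ : E.Rat →ₗ[X.functionField] (hom (hom E L) L).Rat) := by
  have hinj : Function.Injective
      (LinearMap.applyₗ : E.Rat →ₗ[X.functionField] (hom (hom E L) L).Rat) := by
    rw [← LinearMap.ker_eq_bot, LinearMap.ker_eq_bot']
    intro e he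
    have : Nontrivial L.Rat :=
      Module.nontrivial_of_finrank_pos (R := X.functionField) (by rw [finrank_rat, hL]; simp)
    obtain ⟨l, hl⟩ := exists_ne (0 : L.Rat)
    rw [← Module.forall_dual_apply_eq_zero_iff X.functionField]
    intro f
    have := LinearMap.congr_fun he (f.smulRight l)
    simpa [hl] using this
  refine ⟨hinj, (LinearMap.injective_iff_surjective_of_finrank_eq_finrank ?_).1 hinj⟩
  rw [finrank_rat, finrank_rat (hom (hom E L) L)]
  simp [hL]

/-- Evaluation `E ≅ Hom(Hom(E, L), L)` for a line bundle `L`, on rational sections. -/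
def bidualEquiv (E : VectorBundle X) (hL : L.rank = 1) :
    E.Rat ≃ₗ[X.functionField] (hom (hom E L) L).Rat :=
  LinearEquiv.ofBijective _ (eval_bijective hL)

/-- The transpose of a rational homomorphism `π : Hom(E, L) → E`, where `L` is a line bundle. It
is characterized by `ψ (ᵗπ φ) = φ (π ψ)`, see `apply_transpose`. -/
def transpose (hL : L.rank = 1) :
    (hom (hom E L) E).Rat →ₗ[X.functionField] (hom (hom E L) E).Rat :=
  LinearMap.compRight X.functionField (bidualEquiv E hL).symm.toLinearMap ∘ₗ
    (LinearMap.llcomp X.functionField (hom E L).Rat E.Rat L.Rat).flip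

theorem apply_transpose (hL : L.rank = 1) (π : (hom (hom E L) E).Rat)
    (φ ψ : E.Rat →ₗ[X.functionField] L.Rat) :
    ψ (transpose hL π φ) = φ (π ψ) :=
  LinearMap.congr_fun ((bidualEquiv E hL).apply_symm_apply (φ ∘ₗ π)) ψ

theorem mem_stalk_of_forall (hL : L.rank = 1) {x : X} {e : E.Rat}
    (h : ∀ ψ ∈ (hom E L).stalk x, ψ e ∈ L.stalk x) : e ∈ E.stalk x := by
  obtain ⟨U, hU, b, hb⟩ := E.locallyFree x
  obtain ⟨V, hV, c, hc⟩ := L.locallyFree x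
  let k : Fin L.rank := ⟨0, by omega⟩
  rw [hb x hU, mem_span_frame]
  intro i
  have := h ((b.coord i).smulRight (c k)) (by
    intro e' he'
    rw [hb x hU, mem_span_frame] at he'
    rw [hc x hV, LinearMap.smulRight_apply]
    exact Submodule.smul_mem _ (⟨_, he' i⟩ : localRing x) (Submodule.subset_span ⟨k, rfl⟩))
  rw [hc x hV, mem_span_frame] at this
  simpa using this k

theorem transpose_mem (hL : L.rank = 1) {x : X} {π : (hom (hom E L) E).Rat}
    (h : π ∈ (hom (hom E L) E).stalk x) : transpose hL π ∈ (hom (hom E L) E).stalk x := by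
  intro φ hφ
  refine mem_stalk_of_forall hL fun ψ hψ => ?_
  rw [apply_transpose]
  exact hφ _ (h ψ hψ)

/-- The vector bundle `Hom(Hom(E, L), E)`. -/
abbrev homDual (E L : VectorBundle X) : VectorBundle X := hom (hom E L) E

/-- The transpose of the germ at `x` of a principal part with values in `Hom(Hom(E, L), E)`. -/
def transposeAt (hL : L.rank = 1) (x : X) :
    ((homDual E L).Rat ⧸ (homDual E L).stalk x) →ₗ[localRing x]
      ((homDual E L).Rat ⧸ (homDual E L).stalk x) :=
  Submodule.mapQ _ _ ((transpose hL).restrictScalars (localRing x)) (by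
    intro π h
    exact transpose_mem hL h)

theorem transposeAt_mk (hL : L.rank = 1) (x : X) (π : (homDual E L).Rat) :
    transposeAt hL x (Submodule.Quotient.mk π) = Submodule.Quotient.mk (transpose hL π) := rfl

/-- The transpose of a principal part with values in `Hom(Hom(E, L), E)`. -/
def transposePrin (hL : L.rank = 1) (p : (homDual E L).Prin) : (homDual E L).Prin :=
  ⟨fun x => transposeAt hL x (p.1 x), fun x => by
    obtain ⟨U, hU, π, hπ⟩ := p.2 x
    exact ⟨U, hU, transpose hL π, fun y hy => by simp only [hπ y hy]; rfl⟩⟩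

end Transpose

section Subbundles

/-- A vector subbundle of `W`: a subsheaf that is locally a direct summand, i.e. locally `W` has
a frame of which a part is a frame of the subsheaf. -/
structure Subbundle (W : VectorBundle X) where
  stalk : ∀ x : X, Submodule (localRing x) W.Rat
  rank : ℕ
  locallySummand : ∀ x : X, ∃ U : X.Opens, x ∈ U ∧ ∃ (k : ℕ)
    (b : Module.Basis (Fin rank ⊕ Fin k) X.functionField W.Rat), ∀ y ∈ U,
      W.stalk y = Submodule.span (localRing y) (Set.range b) ∧
      stalk y = Submodule.span (localRing y) (Set.range fun i => b (Sum.inl i))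

variable {E F : VectorBundle X} {p : (hom F E).Prin}

/-- `G` intersects `E` generically in rank `0`: the two meet trivially at the generic point. -/
def Subbundle.MeetsGenericallyTrivially (G : Subbundle (extension p)) : Prop :=
  G.stalk (genericPoint X) ⊓ (E.stalk (genericPoint X)).prod ⊥ = ⊥

/-- `𝒢 = Ker(q)`: the principal part `q` differs from `p` by the principal part of a rational
`β : F → E`, so `[q] = [p] = δ(W)`, and `𝒢` is the lift of the kernel of `q : ℱ → 𝒫rin(E)`
to `𝒲_p` by the map `f ↦ (β f, f)`. -/
def Subbundle.IsKernel (G : Subbundle (extension p)) (q : (hom F E).Prin) : Prop :=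
  ∃ β : (hom F E).Rat, q = p - (hom F E).principalPart β ∧
    ∀ (x : X) (w : E.Rat × F.Rat), w ∈ G.stalk x ↔
      (∃ hf : w.2 ∈ F.stalk x, evalAt ⟨w.2, hf⟩ (q.1 x) = 0) ∧ w.1 = β w.2

/-- `G` is isotropic with respect to a bilinear form `θ`: the form restricts to zero on `G`. -/
def Subbundle.IsIsotropic {W L : VectorBundle X} (G : Subbundle W)
    (θ : W.Rat →ₗ[X.functionField] W.Rat →ₗ[X.functionField] L.Rat) : Prop :=
  ∀ x, ∀ v ∈ G.stalk x, ∀ w ∈ G.stalk x, θ v w = 0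

end Subbundles

section Forms

variable {W L : VectorBundle X}

/-- The rational bilinear form `θ` is a regular nondegenerate form on `W` with values in `L`:
the map `w ↦ θ(w, ·)` is an isomorphism from `W` to `Hom(W, L)`. -/
def IsNondegenerateForm (θ : W.Rat →ₗ[X.functionField] W.Rat →ₗ[X.functionField] L.Rat) : Prop :=
  ∀ x, Set.BijOn θ (W.stalk x) ((hom W L).stalk x)

/-- `θ` is an `L`-valued symplectic form on `W`. -/
def IsSymplecticForm (θ : W.Rat →ₗ[X.functionField] W.Rat →ₗ[X.functionField] L.Rat) : Prop :=
  (∀ v w, θ v w = -θ w v) ∧ IsNondegenerateForm θ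

/-- `θ` is an `L`-valued orthogonal form on `W`. -/
def IsOrthogonalForm (θ : W.Rat →ₗ[X.functionField] W.Rat →ₗ[X.functionField] L.Rat) : Prop :=
  (∀ v w, θ v w = θ w v) ∧ IsNondegenerateForm θ

variable {E : VectorBundle X} (p : (homDual E L).Prin) (α : (homDual E L).Rat)

/-- The form `θ((e₁, φ₁), (e₂, φ₂)) = φ₁(e₂) - φ₂(e₁) - φ₂(α(φ₁))` on the extension `W` of
`Hom(E, L)` by `E` defined by `p`. -/
def symplecticForm : (extension p).Rat →ₗ[X.functionField]
    (extension p).Rat →ₗ[X.functionField] L.Rat :=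
  LinearMap.mk₂ X.functionField (fun v w => v.2 w.1 - w.2 v.1 - w.2 (α v.2))
    (fun _ _ _ => by simp; abel) (fun _ _ _ => by simp [smul_sub])
    (fun _ _ _ => by simp; abel) (fun _ _ _ => by simp [smul_sub])

/-- The form `θ((e₁, φ₁), (e₂, φ₂)) = φ₁(e₂) + φ₂(e₁) - φ₂(α(φ₁))` on the extension `W` of
`Hom(E, L)` by `E` defined by `p`. -/
def orthogonalForm : (extension p).Rat →ₗ[X.functionField]
    (extension p).Rat →ₗ[X.functionField] L.Rat :=
  LinearMap.mk₂ X.functionField (fun v w => v.2 w.1 + w.2 v.1 - w.2 (α v.2))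
    (fun _ _ _ => by simp; abel) (fun _ _ _ => by simp [smul_sub, smul_add])
    (fun _ _ _ => by simp; abel) (fun _ _ _ => by simp [smul_sub, smul_add])

end Forms

end VectorBundle

end Bundles

end CurveBundles

end

open CurveBundles CurveBundles.VectorBundle

/-! Both cases are one argument with a sign `ε`, equal to `-1` (symplectic) or `1` (orthogonal): `ᵗp
+ ε p` is the principal part of `α`, and `θ(v, w) = φ₁(e₂) + ε φ₂(e₁) - φ₂(α φ₁)`.

Near a point, `p` is represented by a rational `π`, and `(e, φ) ↦ (e - π φ, φ)` identifies `W` with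
`E ⊕ F`. In these coordinates `θ` is the standard pairing plus `φ₂((ᵗπ + ε π - α) φ₁)`, whose
coefficient is regular by hypothesis; hence `θ` is regular and nondegenerate
(`isNondegenerateForm_of_transpose_add`).

A subbundle is saturated, so its generic fibre determines it (`Subbundle.mem_stalk_iff`). If it has
rank `n` and meets `E` trivially, that fibre is the graph of a unique rational `β`. A graph vector
`(β φ, φ)` is regular in `W` exactly when `φ` and `(π - β) φ` are regular, that is, when `φ` lies in
the kernel of `q`, the class of `p - β`.

On this graph `θ` is `ψ((ᵗβ + ε β - α) φ)`, while `ᵗq + ε q` is minus the principal part of `ᵗβ + ε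
β - α`. As `Hom(F, E)` has no nonzero global sections, the two vanish together
(`isIsotropic_iff_of_isKernel`). -/

namespace CurveBundles.VectorBundle

/-! ### The generic point and biduality -/

variable {X : Scheme.{0}} [AlgebraicGeometry.IsIntegral X]

/-- At the generic point the local ring is the whole function field. -/
theorem mem_localRing_genericPoint (a : X.functionField) : a ∈ localRing (genericPoint X) := by
  obtain ⟨U, hU, r, rfl⟩ := X.presheaf.exists_germ_eq a
  exact germ_mem_localRing hU r

/-- Every rational section is regular at the generic point. -/
theorem mem_stalk_genericPoint (E : VectorBundle X) (e : E.Rat) :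
    e ∈ E.stalk (genericPoint X) := by
  obtain ⟨U, hU, b, hb⟩ := E.locallyFree (genericPoint X)
  rw [hb _ hU, mem_span_frame]
  exact fun i => mem_localRing_genericPoint _

theorem eq_zero_of_forall_apply_eq_zero {E L : VectorBundle X} (hL : L.rank = 1) {e : E.Rat}
    (h : ∀ ψ : (hom E L).Rat, ψ e = 0) : e = 0 :=
  (bidualEquiv E hL).injective (LinearMap.ext fun ψ => (h ψ).trans (map_zero ψ).symm)

theorem transpose_transpose {E L : VectorBundle X} (hL : L.rank = 1) (π : (homDual E L).Rat) :
    transpose hL (transpose hL π) = π := by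
  refine LinearMap.ext fun φ => sub_eq_zero.1 (eq_zero_of_forall_apply_eq_zero hL fun ψ => ?_)
  rw [map_sub, apply_transpose, apply_transpose, sub_self]

/-! ### Saturation of subbundles -/

section Kernels

variable {E F : VectorBundle X}

theorem evalAt_eq_zero_iff {x : X} {f : F.Rat} (hf : f ∈ F.stalk x) (π : (hom F E).Rat) :
    evalAt (E := E) ⟨f, hf⟩ (Submodule.Quotient.mk π) = 0 ↔ π f ∈ E.stalk x := by
  rw [evalAt_mk, Submodule.Quotient.mk_eq_zero]

/-- A vector lies in the local span of a part of a frame iff it lies in the local span of the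
whole frame and in the rational span of the part. -/
theorem mem_span_inl {ι κ V : Type*} [AddCommGroup V] [Module X.functionField V] {x : X}
    (b : Module.Basis (ι ⊕ κ) X.functionField V) (v : V) :
    v ∈ Submodule.span (localRing x) (Set.range fun i => b (Sum.inl i)) ↔
      v ∈ Submodule.span (localRing x) (Set.range b) ∧
      v ∈ Submodule.span X.functionField (Set.range fun i => b (Sum.inl i)) := by
  have hr : (Set.range fun i => b (Sum.inl i)) = b '' Set.range Sum.inl := by
    rw [← Set.range_comp]; rfl
  constructor
  · intro h
    refine ⟨Submodule.span_mono ?_ h, Submodule.span_le_restrictScalars (localRing x) _ _ h⟩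
    rintro _ ⟨i, rfl⟩
    exact ⟨_, rfl⟩
  · rintro ⟨h1, h2⟩
    rw [mem_span_frame] at h1
    rw [hr, b.mem_span_image] at h2
    -- The first condition makes the coordinates regular, the second confines them to the `inl` part
    -- of the frame.
    rw [← b.linearCombination_repr v, Finsupp.linearCombination_apply]
    refine Submodule.sum_mem _ fun i hi => ?_
    obtain ⟨j, rfl⟩ := h2 hi
    exact Submodule.smul_mem _ (⟨_, h1 _⟩ : localRing x) (Submodule.subset_span ⟨j, rfl⟩)

theorem span_genericPoint {V : Type*} [AddCommGroup V] [Module X.functionField V] (s : Set V)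
    (v : V) : v ∈ Submodule.span (localRing (genericPoint X)) s ↔
      v ∈ Submodule.span X.functionField s := by
  refine ⟨fun h => Submodule.span_le_restrictScalars (localRing (genericPoint X)) _ _ h, fun h => ?_⟩
  induction h using Submodule.span_induction with
  | mem _ h => exact Submodule.subset_span h
  | zero => exact zero_mem _
  | add _ _ _ _ h1 h2 => exact add_mem h1 h2
  | smul a _ _ h =>
    exact Submodule.smul_mem _ (⟨a, mem_localRing_genericPoint a⟩ : localRing (genericPoint X)) h

/-- The rational sections of a subbundle. -/
def Subbundle.rat {W : VectorBundle X} (G : Subbundle W) : Submodule X.functionField W.Rat where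
  carrier := G.stalk (genericPoint X)
  add_mem' := add_mem
  zero_mem' := zero_mem _
  smul_mem' a _ h := Submodule.smul_mem _
    (⟨a, mem_localRing_genericPoint a⟩ : localRing (genericPoint X)) h

theorem Subbundle.mem_rat {W : VectorBundle X} {G : Subbundle W} {w : W.Rat} :
    w ∈ G.rat ↔ w ∈ G.stalk (genericPoint X) := Iff.rfl

/-- A subbundle is saturated. -/
theorem Subbundle.mem_stalk_iff {W : VectorBundle X} (G : Subbundle W) (x : X) (w : W.Rat) :
    w ∈ G.stalk x ↔ w ∈ W.stalk x ∧ w ∈ G.rat := by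
  obtain ⟨U, hU, k, b, hb⟩ := G.locallySummand x
  rw [Subbundle.mem_rat, (hb _ (genericPoint_mem hU)).2, (hb x hU).1, (hb x hU).2,
    span_genericPoint, mem_span_inl]

theorem Subbundle.finrank_rat {W : VectorBundle X} (G : Subbundle W) :
    Module.finrank X.functionField G.rat = G.rank := by
  obtain ⟨U, hU, k, b, hb⟩ := G.locallySummand (genericPoint X)
  have : G.rat = Submodule.span X.functionField (Set.range fun i => b (Sum.inl i)) := by
    ext w
    rw [Subbundle.mem_rat, (hb _ hU).2, span_genericPoint]
  rw [this]
  exact (finrank_span_eq_card (b.linearIndependent.comp _ Sum.inl_injective)).trans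
    (Fintype.card_fin _)

/-! ### Subbundles as graphs and as lifts of kernels -/

variable {p : (hom F E).Prin}

/-- A subbundle of rank `rank F` meeting `E` trivially is generically the graph of a rational
homomorphism. -/
theorem Subbundle.exists_graph (G : Subbundle (extension p)) (hr : G.rank = F.rank)
    (hG : G.MeetsGenericallyTrivially) :
    ∃ β : (hom F E).Rat, ∀ w : E.Rat × F.Rat, w ∈ G.rat ↔ w.1 = β w.2 := by
  -- The kernel of this projection is the generic intersection of `G` with `E`, so it is injective,
  -- and equality of ranks makes it bijective. Then `β` is its inverse followed by the projection to
  -- `E`.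
  let pr : G.rat →ₗ[X.functionField] F.Rat :=
    LinearMap.snd X.functionField E.Rat F.Rat ∘ₗ G.rat.subtype
  have hinj : Function.Injective pr := by
    rw [← LinearMap.ker_eq_bot, LinearMap.ker_eq_bot']
    rintro ⟨⟨e, f⟩, hw⟩ h
    have hf : f = 0 := h
    have hmem : ((e, f) : E.Rat × F.Rat) ∈
        G.stalk (genericPoint X) ⊓ (E.stalk (genericPoint X)).prod ⊥ :=
      ⟨hw, mem_stalk_genericPoint E e, hf⟩
    rw [hG] at hmem
    exact Subtype.ext hmem
  have hsurj : Function.Surjective pr := by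
    have : Module.Finite X.functionField (E.Rat × F.Rat) := finite_rat (extension p)
    refine (LinearMap.injective_iff_surjective_of_finrank_eq_finrank ?_).1 hinj
    rw [G.finrank_rat, hr, VectorBundle.finrank_rat]
  let eq := LinearEquiv.ofBijective pr ⟨hinj, hsurj⟩
  have hsnd : ∀ f, (eq.symm f : E.Rat × F.Rat).2 = f := eq.apply_symm_apply
  refine ⟨LinearMap.fst X.functionField E.Rat F.Rat ∘ₗ G.rat.subtype ∘ₗ eq.symm.toLinearMap,
    fun w => ⟨fun h => ?_, fun h => ?_⟩⟩
  · have : eq.symm w.2 = ⟨w, h⟩ := eq.symm_apply_eq.2 rfl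
    simp [this]
  · have : (eq.symm w.2 : E.Rat × F.Rat) = w := Prod.ext h.symm (hsnd w.2)
    rw [← this]
    exact (eq.symm w.2).2

/-- By saturation only regularity in `W` has to be tested on graph vectors: if `π` represents `p` at
`x`, then `π - β` represents `q`, and the two regularity conditions differ by a sign. -/
theorem Subbundle.isKernel_of_graph {G : Subbundle (extension p)} {β : (hom F E).Rat}
    (hβ : ∀ w : E.Rat × F.Rat, w ∈ G.rat ↔ w.1 = β w.2) :
    G.IsKernel (p - (hom F E).principalPart β) := by
  refine ⟨β, rfl, fun x w => ?_⟩
  obtain ⟨π, hπ⟩ := Submodule.Quotient.mk_surjective _ (p.1 x)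
  have hq : (p - (hom F E).principalPart β).1 x = Submodule.Quotient.mk (π - β) := by
    rw [Submodule.Quotient.mk_sub, hπ]; rfl
  rw [G.mem_stalk_iff, hβ, mem_extensionStalk hπ.symm]
  refine and_congr_left fun hw => ?_
  rw [hw, hq]
  have : β w.2 - π w.2 = -((π - β) w.2) := by simp
  rw [this, neg_mem_iff]
  exact ⟨fun h => ⟨h.1, (evalAt_eq_zero_iff h.1 _).2 h.2⟩,
    fun h => ⟨h.1, (evalAt_eq_zero_iff h.1 _).1 h.2⟩⟩

/-- At the generic point every rational section is regular, so the kernel condition is vacuous there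
and only the graph of `β` remains. -/
theorem Subbundle.IsKernel.exists_graph {G : Subbundle (extension p)} {q : (hom F E).Prin}
    (h : G.IsKernel q) : ∃ β : (hom F E).Rat, q = p - (hom F E).principalPart β ∧
      ∀ w : E.Rat × F.Rat, w ∈ G.rat ↔ w.1 = β w.2 := by
  obtain ⟨β, hq, hβ⟩ := h
  refine ⟨β, hq, fun w => (hβ _ w).trans (and_iff_right ⟨mem_stalk_genericPoint F _, ?_⟩)⟩
  obtain ⟨π, hπ⟩ := Submodule.Quotient.mk_surjective _ (q.1 (genericPoint X))
  rw [← hπ, evalAt_eq_zero_iff]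
  exact mem_stalk_genericPoint E _

/-- Uniqueness holds because the generic fibre, being a graph, determines `β` and hence `q`. -/
theorem Subbundle.existsUnique_isKernel (G : Subbundle (extension p)) (hr : G.rank = F.rank)
    (hG : G.MeetsGenericallyTrivially) : ∃! q, G.IsKernel q := by
  obtain ⟨β, hβ⟩ := G.exists_graph hr hG
  refine ⟨_, isKernel_of_graph hβ, fun q hq => ?_⟩
  obtain ⟨γ, rfl, hγ⟩ := hq.exists_graph
  have : γ = β := LinearMap.ext fun f => (hβ (γ f, f)).1 ((hγ (γ f, f)).2 rfl)
  rw [this]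

end Kernels

/-! ### Principal parts and their transposes -/

section Forms

variable {E L : VectorBundle X} {p : (homDual E L).Prin} {α : (homDual E L).Rat} {ε : ℤ}

/-- A rational section with zero principal part is regular everywhere. This is where the absence of
global sections enters: it lifts identities of principal parts to rational homomorphisms. -/
theorem principalPart_eq_zero_iff (h0 : E.globalSections = {0}) (s : E.Rat) :
    E.principalPart s = 0 ↔ s = 0 := by
  refine ⟨fun h => ?_, fun h => h ▸ map_zero _⟩
  have : s ∈ E.globalSections := fun x =>
    (Submodule.Quotient.mk_eq_zero _).1 (congrFun (congrArg Subtype.val h) x)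
  rwa [h0] at this

theorem transposePrin_add (hL : L.rank = 1) (p q : (homDual E L).Prin) :
    transposePrin hL (p + q) = transposePrin hL p + transposePrin hL q :=
  Subtype.ext (funext fun x => map_add (transposeAt hL x) (p.1 x) (q.1 x))

/-- The transpose on principal parts as a group homomorphism. -/
noncomputable def transposePrinHom (hL : L.rank = 1) : (homDual E L).Prin →+ (homDual E L).Prin :=
  AddMonoidHom.mk' (transposePrin hL) (transposePrin_add hL)

theorem transposePrin_eq (hL : L.rank = 1) (p : (homDual E L).Prin) :
    transposePrin hL p = transposePrinHom hL p := rfl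

theorem transposePrinHom_principalPart (hL : L.rank = 1) (π : (homDual E L).Rat) :
    transposePrinHom hL (principalPart _ π) = principalPart _ (transpose hL π) := rfl

theorem transposePrinHom_transposePrinHom (hL : L.rank = 1) (p : (homDual E L).Prin) :
    transposePrinHom hL (transposePrinHom hL p) = p := by
  refine Subtype.ext (funext fun x => ?_)
  change transposeAt hL x (transposeAt hL x (p.1 x)) = p.1 x
  obtain ⟨π, hπ⟩ := Submodule.Quotient.mk_surjective _ (p.1 x)
  rw [← hπ, transposeAt_mk, transposeAt_mk, transpose_transpose]

/-- If `ᵗp + ε p` is the principal part of `α`, with `ε = ±1`, then `ᵗα = ε α`. -/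
theorem transpose_eq_zsmul (hL : L.rank = 1) (h0 : (homDual E L).globalSections = {0})
    (hε : ε * ε = 1) (hp : transposePrinHom hL p + ε • p = principalPart _ α) :
    transpose hL α = ε • α := by
  -- Transposing `ᵗp + ε p` gives `p + ε ᵗp`, which is `ε (ᵗp + ε p)` because `ε² = 1`.
  rw [← sub_eq_zero, ← principalPart_eq_zero_iff h0, map_sub, map_zsmul,
    ← transposePrinHom_principalPart, ← hp, map_add, map_zsmul,
    transposePrinHom_transposePrinHom, zsmul_add, ← mul_zsmul, hε, one_zsmul, add_comm, sub_self]

/-- The difference of the germs of `ᵗp + ε p` and of `α` is regular. -/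
theorem transpose_add_zsmul_sub_mem (hL : L.rank = 1)
    (hp : transposePrinHom hL p + ε • p = principalPart _ α) {x : X} {π : (homDual E L).Rat}
    (hπ : p.1 x = Submodule.Quotient.mk π) :
    transpose hL π + ε • π - α ∈ (homDual E L).stalk x := by
  have h : transposeAt hL x (p.1 x) + ε • p.1 x = Submodule.Quotient.mk α :=
    congrFun (congrArg Subtype.val hp) x
  rw [hπ, transposeAt_mk] at h
  exact (Submodule.Quotient.eq _).1 h

/-! ### The form `θ` with sign `ε` -/

variable {θ : (extension p).Rat →ₗ[X.functionField] (extension p).Rat →ₗ[X.functionField] L.Rat}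

theorem apply_swap_of_transpose_eq (hL : L.rank = 1) (hε : ε * ε = 1)
    (hθ : ∀ v w : E.Rat × (hom E L).Rat, θ v w = v.2 w.1 + ε • w.2 v.1 - w.2 (α v.2))
    (hα : transpose hL α = ε • α) (v w : (extension p).Rat) : θ v w = ε • θ w v := by
  have h : v.2 (α w.2) = ε • w.2 (α v.2) := by
    rw [← apply_transpose hL, hα, LinearMap.smul_apply, map_zsmul]
  rw [hθ, hθ, h, smul_sub, smul_add, smul_smul, smul_smul, hε, one_smul, one_smul,
    add_comm (v.2 w.1)]

theorem isNondegenerateForm_of_transpose_add (hL : L.rank = 1) (hε : ε * ε = 1)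
    (hp : transposePrinHom hL p + ε • p = principalPart _ α)
    (hθ : ∀ v w : E.Rat × (hom E L).Rat, θ v w = v.2 w.1 + ε • w.2 v.1 - w.2 (α v.2)) :
    IsNondegenerateForm (W := extension p) θ := by
  intro x
  obtain ⟨π, hπ⟩ := Submodule.Quotient.mk_surjective _ (p.1 x)
  have hreg := transpose_add_zsmul_sub_mem hL hp hπ.symm
  have hmem := mem_extensionStalk hπ.symm
  refine ⟨fun v hv w hw => ?_, fun v _ w _ h => ?_, fun Λ hΛ => ?_⟩
  · obtain ⟨hv2, hv1⟩ := (hmem v).1 hv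
    obtain ⟨hw2, hw1⟩ := (hmem w).1 hw
    -- Expansion of `θ` in the local coordinates `e - π φ`; each of the three terms is regular.
    have : θ v w = w.2 ((transpose hL π + ε • π - α) v.2) + v.2 (w.1 - π w.2) +
        ε • w.2 (v.1 - π v.2) := by
      rw [hθ]
      simp only [LinearMap.sub_apply, LinearMap.add_apply, LinearMap.smul_apply, map_sub, map_add,
        map_zsmul, smul_sub]
      rw [apply_transpose]
      abel
    rw [this]
    exact add_mem (add_mem (hw2 _ (hreg _ hv2)) (hv2 _ hw1)) (zsmul_mem (hw2 _ hv1) ε)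
  · rw [← sub_eq_zero] at h ⊢
    rw [← map_sub] at h
    generalize v - w = u at h
    obtain ⟨e, φ⟩ := u
    have hz : ∀ w : E.Rat × (hom E L).Rat, φ w.1 + ε • w.2 e - w.2 (α φ) = 0 := fun w =>
      (hθ (e, φ) w).symm.trans (LinearMap.congr_fun h w)
    -- Injectivity already holds on rational sections: testing against `E` kills `φ`, then testing
    -- against `F` kills `e`.
    have hφ : φ = 0 := LinearMap.ext fun e' => by simpa using hz (e', 0)
    subst hφ
    have he : e = 0 := eq_zero_of_forall_apply_eq_zero hL fun ψ => by
      have := congrArg (ε • ·) (hz (0, ψ))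
      simpa [smul_smul, hε] using this
    rw [he]; rfl
  -- Surjectivity: `φ` is the restriction of `Λ` to `E`, and `e` represents, by biduality, its
  -- restriction to the rational summand `F`.
  · let φ : (hom E L).Rat := Λ ∘ₗ LinearMap.inl X.functionField E.Rat (hom E L).Rat
    let e : E.Rat := (bidualEquiv E hL).symm (Λ ∘ₗ LinearMap.inr X.functionField E.Rat _)
    have he : ∀ ψ : (hom E L).Rat, ψ e = Λ (0, ψ) := fun ψ =>
      LinearMap.congr_fun ((bidualEquiv E hL).apply_symm_apply _) ψ
    have hφ : ∀ e', φ e' = Λ (e', 0) := fun _ => rfl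
    have hΛ' : ∀ e' ψ, Λ (e', ψ) = φ e' + ψ e := fun e' ψ => by
      rw [he, hφ, ← map_add, Prod.mk_add_mk, add_zero, zero_add]
    have hφx : φ ∈ (hom E L).stalk x := fun e' he' =>
      hΛ _ ((hmem _).2 ⟨zero_mem _, by simpa using he'⟩)
    -- The first component `e₁` solves `ε e₁ - α φ = e`, as needed for `θ((e₁, φ), ·) = Λ`.
    refine ⟨(ε • (e + α φ), φ), (hmem _).2 ⟨hφx, mem_stalk_of_forall hL fun ψ hψ => ?_⟩,
      LinearMap.ext fun w => ?_⟩
    -- Regularity of `e₁ - π φ` is tested against regular `ψ`, using that `(π ψ, ψ)` is a regular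
    -- section of `W`, on which `Λ` is regular.
    · have h1 : Λ (π ψ, ψ) ∈ L.stalk x := hΛ _ ((hmem _).2 ⟨hψ, by simp⟩)
      have h2 := hψ _ (hreg _ hφx)
      have : ψ (ε • (e + α φ) - π φ) =
          ε • (Λ (π ψ, ψ) - ψ ((transpose hL π + ε • π - α) φ)) := by
        rw [hΛ']
        simp only [LinearMap.sub_apply, LinearMap.add_apply, LinearMap.smul_apply, map_sub,
          map_add, map_zsmul, smul_sub, smul_add, smul_smul, hε, one_smul]
        rw [apply_transpose]
        abel
      rw [this]
      exact zsmul_mem (sub_mem h1 h2) ε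
    · obtain ⟨e', ψ⟩ := w
      rw [hθ, hΛ']
      simp only [map_add, map_zsmul, smul_add, smul_smul, hε, one_smul]
      abel

theorem isIsotropic_iff_of_isKernel (hL : L.rank = 1) (h0 : (homDual E L).globalSections = {0})
    (hp : transposePrinHom hL p + ε • p = principalPart _ α)
    (hθ : ∀ v w : E.Rat × (hom E L).Rat, θ v w = v.2 w.1 + ε • w.2 v.1 - w.2 (α v.2))
    {G : Subbundle (extension p)} {q : (homDual E L).Prin} (hq : G.IsKernel q) :
    G.IsIsotropic θ ↔ transposePrinHom hL q + ε • q = 0 := by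
  obtain ⟨β, rfl, hβ⟩ := hq.exists_graph
  have hval : ∀ φ ψ : (hom E L).Rat,
      θ (β φ, φ) (β ψ, ψ) = ψ ((transpose hL β + ε • β - α) φ) := fun φ ψ => by
    rw [hθ]
    simp only [LinearMap.sub_apply, LinearMap.add_apply, LinearMap.smul_apply, map_sub, map_add,
      map_zsmul]
    rw [apply_transpose]
  have hpp : transposePrinHom hL (p - principalPart _ β) + ε • (p - principalPart _ β) =
      -principalPart _ (transpose hL β + ε • β - α) := by
    rw [map_sub, map_sub, map_add, map_zsmul, ← hp, transposePrinHom_principalPart, zsmul_sub]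
    abel
  rw [hpp, neg_eq_zero, principalPart_eq_zero_iff h0]
  -- Forward, isotropy at the generic point suffices, as the whole graph lies in that stalk.
  -- Conversely, every stalk of `G` lies in the graph.
  constructor
  · intro h
    refine LinearMap.ext fun φ => eq_zero_of_forall_apply_eq_zero hL fun ψ => ?_
    rw [← hval]
    exact h _ _ ((hβ (β φ, φ)).2 rfl) _ ((hβ (β ψ, ψ)).2 rfl)
  · intro h x v hv w hw
    have hv' : v = (β v.2, v.2) := Prod.ext ((hβ v).1 ((G.mem_stalk_iff x v).1 hv).2) rfl
    have hw' : w = (β w.2, w.2) := Prod.ext ((hβ w).1 ((G.mem_stalk_iff x w).1 hw).2) rfl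
    rw [hv', hw', hval, h, LinearMap.zero_apply, map_zero]

end Forms

end CurveBundles.VectorBundle

/-- Isotropy of the subbundles `Ker(q)` of a symplectic (resp. orthogonal) extension of
`Hom(E, L)` by `E`. -/
theorem mainTheorem4 (X : Scheme.{0}) [AlgebraicGeometry.IsIntegral X] (s : X ⟶ Spec (.of ℂ))
    [SmoothOfRelativeDimension 1 s] (hX : IsProjective s)
    (n : ℕ) (ℰ ℒ : X.Modules) (hE : IsLocallyFreeOfRank ℰ n) (hL : IsLocallyFreeOfRank ℒ 1)
    (h0 : (homDual (ofModules hE) (ofModules hL)).globalSections = {0})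
    (p : (homDual (ofModules hE) (ofModules hL)).Prin)
    (α : (homDual (ofModules hE) (ofModules hL)).Rat) :
    (transposePrin rfl p - p = principalPart _ α →
      IsSymplecticForm (symplecticForm p α) ∧
      ∀ G : Subbundle (extension p), G.rank = n → G.MeetsGenericallyTrivially →
        (∃! q, G.IsKernel q) ∧
        ∀ q, G.IsKernel q → (G.IsIsotropic (symplecticForm p α) ↔ transposePrin rfl q = q)) ∧
    (transposePrin rfl p + p = principalPart _ α →
      IsOrthogonalForm (orthogonalForm p α) ∧
      ∀ G : Subbundle (extension p), G.rank = n → G.MeetsGenericallyTrivially →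
        (∃! q, G.IsKernel q) ∧
        ∀ q, G.IsKernel q → (G.IsIsotropic (orthogonalForm p α) ↔ transposePrin rfl q = -q)) := by
  have hr : (hom (ofModules hE) (ofModules hL)).rank = n := one_mul n
  refine ⟨fun hp => ?_, fun hp => ?_⟩
  -- Symplectic case: `ε = -1`.
  · have hp' : transposePrinHom rfl p + (-1 : ℤ) • p = principalPart _ α := by
      rw [← hp, neg_one_smul, ← sub_eq_add_neg]; rfl
    have hθ : ∀ v w, symplecticForm p α v w =
        v.2 w.1 + (-1 : ℤ) • w.2 v.1 - w.2 (α v.2) := fun v w => by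
      rw [neg_one_smul, ← sub_eq_add_neg]; rfl
    have hε : (-1 : ℤ) * -1 = 1 := rfl
    refine ⟨⟨fun v w => ?_, isNondegenerateForm_of_transpose_add rfl hε hp' hθ⟩,
      fun G hG hGE => ⟨G.existsUnique_isKernel (hG.trans hr.symm) hGE, fun q hq => ?_⟩⟩
    · rw [apply_swap_of_transpose_eq rfl hε hθ (transpose_eq_zsmul rfl h0 hε hp'), neg_one_smul]
    · rw [isIsotropic_iff_of_isKernel rfl h0 hp' hθ hq, neg_one_smul, ← sub_eq_add_neg,
        sub_eq_zero, transposePrin_eq]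
  -- Orthogonal case: `ε = 1`.
  · have hp' : transposePrinHom rfl p + (1 : ℤ) • p = principalPart _ α := by
      rw [← hp, one_smul]; rfl
    have hθ : ∀ v w, orthogonalForm p α v w =
        v.2 w.1 + (1 : ℤ) • w.2 v.1 - w.2 (α v.2) := fun v w => by
      rw [one_smul]; rfl
    have hε : (1 : ℤ) * 1 = 1 := rfl
    refine ⟨⟨fun v w => ?_, isNondegenerateForm_of_transpose_add rfl hε hp' hθ⟩,
      fun G hG hGE => ⟨G.existsUnique_isKernel (hG.trans hr.symm) hGE, fun q hq => ?_⟩⟩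
    · rw [apply_swap_of_transpose_eq rfl hε hθ (transpose_eq_zsmul rfl h0 hε hp'), one_smul]
    · rw [isIsotropic_iff_of_isKernel rfl h0 hp' hθ hq, one_smul, add_eq_zero_iff_eq_neg,
        transposePrin_eq]
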